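/- Work in a second-order set theory over the universe $V$ of sets. Let $\kappa\le\theta$ be cardinals. A $\theta$-supercompactness embedding with critical point $\kappa$ is an elementary embedding $j\colon V\to M$ (for the language $\{\in\}$) into a transitive class $M$ containing all ordinals such that $\kappa$ is the least ordinal moved by $j$, $\theta<j(\kappa)$, and every function from $\theta$ to $M$ is an element of $M$. A function $\ell\colon\kappa\to V_\kappa$ guesses $a$ via $j$ if $j(\ell)(\kappa)=a$. Let $H_{\theta^+}$ be the set of all sets whose transitive closure has size at most $\theta$. A function $\ell\colon\kappa\to V_\kappa$ is a $\theta$-supercompactness Laver function for $\kappa$ if every $a\in H_{\theta^+}$ is guessed by $\ell$ via some $\theta$-supercompactness embedding with critical point $\kappa$. A sequence $\langle\ell_\alpha;\alpha<\lambda\rangle$ of $\theta$-supercompactness Laver functions for $\kappa$ is a $\theta$-supercompactness joint Laver sequence for $\kappa$ of length $\lambda$ if for every sequence $\langle a_\alpha;\alpha<\lambda\rangle$ of elements of $H_{\theta^+}$ there is a single $\theta$-supercompactness embedding $j$ with critical point $\kappa$ such that $j(\ell_\alpha)(\kappa)=a_\alpha$ for all $\alpha<\lambda$. Proposition. (1)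 If there is a $\theta$-supercompactness Laver function for $\kappa$, then there is a $\theta$-supercompactness joint Laver sequence for $\kappa$ of length $\lambda=\min\{\theta,2^\kappa\}$. (2) More precisely, let $\ell$ be a $\theta$-supercompactness Laver function for $\kappa$, let $\lambda=\min\{\theta,2^\kappa\}$, and let $f\colon\lambda\to\mathcal P(\kappa)$ be injective. For $\alpha<\lambda$ and $\xi<\kappa$ let $\ell_\alpha(\xi)=\ell(\xi)(f(\alpha)\cap\xi)$ if $\ell(\xi)$ is a function with $f(\alpha)\cap\xi$ in its domain, and $\ell_\alpha(\xi)=\emptyset$ otherwise. Then $\langle\ell_\alpha;\alpha<\lambda\rangle$ is a $\theta$-supercompactness joint Laver sequence for $\kappa$. (3) If some $\ell$ is a $\theta'$-supercompactness Laver function for $\kappa$ for every cardinal $\theta'\ge\kappa$, then there is a sequence of length $2^\kappa$ which is a $\theta'$-supercompactness joint Laver sequence for $\kappa$ for every cardinal $\theta'\ge\kappa$. -/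

import Mathlib

open FirstOrder

universe u

namespace JointLaver

/-- The relation symbols of the language of set theory: a single binary symbol. -/
inductive MemRel : ℕ → Type
  | mem : MemRel 2

/-- The first-order language of set theory `{∈}`. -/
def setLang : FirstOrder.Language.{0, 0} := ⟨fun _ => Empty, MemRel⟩

/-- The universe of sets `V = ZFSet`, as a structure for the language of set theory. -/
instance instStructureV : setLang.Structure ZFSet.{u} where
  funMap := fun f => f.elim
  RelMap := fun {_} r =>
    match r with
    | .mem => fun v => v 0 ∈ v 1

/-- A class `M` of sets with the true membership relation, as a structure for the language of
set theory. -/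
instance instStructureClass (M : Set ZFSet.{u}) : setLang.Structure M where
  funMap := fun f => f.elim
  RelMap := fun {_} r =>
    match r with
    | .mem => fun v => (v 0 : ZFSet.{u}) ∈ (v 1 : ZFSet.{u})

/-- A cardinal, as a von Neumann (initial) ordinal in `ZFSet`. -/
noncomputable def cardSet (κ : Cardinal.{u}) : ZFSet.{u} := κ.ord.toZFSet

/-- `x ∈ H_μ`: the transitive closure of `x` has size less than `μ`; equivalently, `x` is
included in some transitive set of size less than `μ`. -/
def InH (μ : Cardinal.{u}) (x : ZFSet.{u}) : Prop :=
  ∃ t : ZFSet.{u}, t.IsTransitive ∧ x ⊆ t ∧ t.card < μ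

/-- `j : V → M` is a `θ`-supercompactness embedding with critical point `κ`. That `j` is
elementary for the language of set theory is part of the type of `j`; with the first two fields
this makes `M` an inner model of ZFC. -/
structure IsSupercompactnessEmbedding (κ θ : Cardinal.{u}) (M : Set ZFSet.{u})
    (j : ZFSet.{u} ↪ₑ[setLang] M) : Prop where
  /-- `M` is transitive. -/
  transitive : ∀ x ∈ M, ∀ y ∈ x, y ∈ M
  /-- `M` contains all ordinals. -/
  ordinals : ∀ o : Ordinal.{u}, o.toZFSet ∈ M
  /-- Ordinals below `κ` are fixed by `j`. -/
  fix : ∀ o < κ.ord, (j o.toZFSet : ZFSet.{u}) = o.toZFSet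
  /-- `κ` is moved by `j`. -/
  move : (j (cardSet κ) : ZFSet.{u}) ≠ cardSet κ
  /-- `θ < j(κ)`. -/
  lt_image : cardSet θ ∈ (j (cardSet κ) : ZFSet.{u})
  /-- `M` is closed under `θ`-sequences: each function from `θ` to a set of elements of `M` is an
  element of `M`. -/
  closed : ∀ D s : ZFSet.{u}, (∀ y ∈ D, y ∈ M) → ZFSet.IsFunc (cardSet θ) D s → s ∈ M

/-- `ℓ` guesses `a` via `j`, that is `j(ℓ)(κ) = a`. -/
def Guesses (κ : Cardinal.{u}) {M : Set ZFSet.{u}} (j : ZFSet.{u} ↪ₑ[setLang] M)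
    (ℓ a : ZFSet.{u}) : Prop :=
  ZFSet.pair (cardSet κ) a ∈ (j ℓ : ZFSet.{u})

/-- `ℓ : κ → V_κ` is a `θ`-supercompactness Laver function for `κ`: each target in `H_{θ⁺}` is
guessed by `ℓ` via some `θ`-supercompactness embedding with critical point `κ`. -/
def IsLaverFunction (κ θ : Cardinal.{u}) (ℓ : ZFSet.{u}) : Prop :=
  ZFSet.IsFunc (cardSet κ) (ZFSet.vonNeumann κ.ord) ℓ ∧
  ∀ a : ZFSet.{u}, InH (Order.succ θ) a →
    ∃ (M : Set ZFSet.{u}) (j : ZFSet.{u} ↪ₑ[setLang] M),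
      IsSupercompactnessEmbedding κ θ M j ∧ Guesses κ j ℓ a

/-- `L = ⟨ℓ_α ; α < Λ⟩` is a `θ`-supercompactness joint Laver sequence for `κ` of length `Λ`. -/
def IsJointLaverSequence (κ θ : Cardinal.{u}) (Λ : Ordinal.{u})
    (L : Set.Iio Λ → ZFSet.{u}) : Prop :=
  (∀ α, IsLaverFunction κ θ (L α)) ∧
  ∀ a : Set.Iio Λ → ZFSet.{u}, (∀ α, InH (Order.succ θ) (a α)) →
    ∃ (M : Set ZFSet.{u}) (j : ZFSet.{u} ↪ₑ[setLang] M),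
      IsSupercompactnessEmbedding κ θ M j ∧ ∀ α, Guesses κ j (L α) (a α)

/-- `g` is a function: a single-valued set of ordered pairs. -/
def IsFunction (g : ZFSet.{u}) : Prop :=
  (∀ z ∈ g, ∃ x y, z = ZFSet.pair x y) ∧
  ∀ x y y', ZFSet.pair x y ∈ g → ZFSet.pair x y' ∈ g → y = y'

open Classical in
/-- `g(x)` if `g` is a function with `x` in its domain, and `∅` otherwise. -/
noncomputable def eval (g x : ZFSet.{u}) : ZFSet.{u} :=
  if h : IsFunction g ∧ ∃ y, ZFSet.pair x y ∈ g then h.2.choose else ∅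

/-- For `A ⊆ κ`, the function on `κ` given by `ξ ↦ ℓ(ξ)(A ∩ ξ)` if this makes sense and `ξ ↦ ∅`
otherwise. -/
noncomputable def slice (κ : Cardinal.{u}) (ℓ A : ZFSet.{u}) : ZFSet.{u} :=
  ZFSet.range fun ξ : Set.Iio κ.ord =>
    ZFSet.pair ξ.1.toZFSet (eval (eval ℓ ξ.1.toZFSet) (A ∩ ξ.1.toZFSet))

end JointLaver

/-!
Given targets `a α`, let `ℓ` guess the single function `g` with `g (f α) = a α`, which lies in
`H_{θ⁺}` because it has at most `θ` elements. If `j` is a `θ`-supercompactness embedding with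
critical point `κ` and `j(ℓ)(κ) = g`, then `j` sends the slice of `ℓ` at `f α` to the slice of
`j(ℓ)` at `j (f α)`, whose value at `κ` is `g (j (f α) ∩ κ) = g (f α) = a α`.

For a function that is Laver for all degrees, the slices are jointly Laver for all degrees at least
`2 ^ κ`, and joint Laver sequences remain so for smaller degrees.
-/

namespace JointLaver

open FirstOrder.Language Cardinal

universe v

/-! ### Absoluteness -/

/-- A transitive class of sets. -/
def IsTransitiveClass (M : Set ZFSet.{u}) : Prop :=
  ∀ x ∈ M, ∀ y ∈ x, y ∈ M

theorem IsTransitiveClass.mem_of_pair_mem {M : Set ZFSet.{u}} (hM : IsTransitiveClass M)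
    {x y : ZFSet.{u}} (h : ZFSet.pair x y ∈ M) : x ∈ M ∧ y ∈ M := by
  have hxy : {x, y} ∈ M := hM _ h _ (by simp [ZFSet.pair])
  exact ⟨hM _ hxy _ (by simp), hM _ hxy _ (by simp)⟩

/-- A predicate on tuples of sets given by a formula of set theory that has the same meaning in `V`
and in all transitive classes. -/
def IsAbsolute {n : ℕ} (P : (Fin n → ZFSet.{u}) → Prop) : Prop :=
  ∃ φ : setLang.BoundedFormula Empty n,
    (∀ v : Fin n → ZFSet.{u}, φ.Realize Empty.elim v ↔ P v) ∧
    ∀ M : Set ZFSet.{u}, IsTransitiveClass M →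
      ∀ v : Fin n → M, φ.Realize Empty.elim v ↔ P fun i => v i

namespace IsAbsolute

variable {n : ℕ} {P Q : (Fin n → ZFSet.{u}) → Prop} {R : (Fin n → ZFSet.{u}) → ZFSet.{u} → Prop}

theorem congr (hP : IsAbsolute P) (h : ∀ v, Q v ↔ P v) : IsAbsolute Q := by
  rwa [funext fun v => propext (h v)]

theorem mem (i k : Fin n) : IsAbsolute fun v : Fin n → ZFSet.{u} => v i ∈ v k :=
  ⟨Relations.boundedFormula (L := setLang) MemRel.mem ![Term.var (Sum.inr i), Term.var (Sum.inr k)],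
    fun _ => Iff.rfl, fun _ _ _ => Iff.rfl⟩

theorem eq (i k : Fin n) : IsAbsolute fun v : Fin n → ZFSet.{u} => v i = v k :=
  ⟨Term.bdEqual (L := setLang) (Term.var (Sum.inr i)) (Term.var (Sum.inr k)),
    fun _ => Iff.rfl, fun _ _ _ => Subtype.ext_iff⟩

theorem imp (hP : IsAbsolute P) (hQ : IsAbsolute Q) : IsAbsolute fun v => P v → Q v := by
  obtain ⟨φ, hφV, hφM⟩ := hP
  obtain ⟨ψ, hψV, hψM⟩ := hQ
  refine ⟨φ.imp ψ, fun v => ?_, fun M hM v => ?_⟩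
  · rw [BoundedFormula.realize_imp, hφV, hψV]
  · rw [BoundedFormula.realize_imp, hφM M hM, hψM M hM]

theorem not (hP : IsAbsolute P) : IsAbsolute fun v => ¬ P v := by
  obtain ⟨φ, hφV, hφM⟩ := hP
  refine ⟨φ.not, fun v => ?_, fun M hM v => ?_⟩
  · rw [BoundedFormula.realize_not, hφV]
  · rw [BoundedFormula.realize_not, hφM M hM]

theorem and (hP : IsAbsolute P) (hQ : IsAbsolute Q) : IsAbsolute fun v => P v ∧ Q v :=
  (hP.imp hQ.not).not.congr fun v => by tauto

theorem or (hP : IsAbsolute P) (hQ : IsAbsolute Q) : IsAbsolute fun v => P v ∨ Q v :=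
  (hP.not.imp hQ).congr fun v => by tauto

theorem all
    (hR : IsAbsolute fun w : Fin (n + 1) → ZFSet.{u} => R (fun k => w k.castSucc) (w (Fin.last n)))
    (hmem : ∀ M : Set ZFSet.{u}, IsTransitiveClass M →
      ∀ (v : Fin n → M) x, ¬ R (fun i => v i) x → x ∈ M) :
    IsAbsolute fun v => ∀ x, R v x := by
  obtain ⟨φ, hφV, hφM⟩ := hR
  refine ⟨φ.all, fun v => ?_, fun M hM v => ?_⟩
  · simp only [BoundedFormula.realize_all, hφV, Fin.snoc_last, Fin.snoc_castSucc]
  · simp only [BoundedFormula.realize_all, hφM M hM, Fin.snoc_last, Fin.snoc_castSucc]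
    exact ⟨fun h x => by_contra fun hx => hx (h ⟨x, hmem M hM v x hx⟩), fun h x => h x⟩

theorem ex
    (hR : IsAbsolute fun w : Fin (n + 1) → ZFSet.{u} => R (fun k => w k.castSucc) (w (Fin.last n)))
    (hmem : ∀ M : Set ZFSet.{u}, IsTransitiveClass M →
      ∀ (v : Fin n → M) x, R (fun i => v i) x → x ∈ M) :
    IsAbsolute fun v => ∃ x, R v x :=
  (all (R := fun v x => ¬ R v x) hR.not fun M hM v x hx => hmem M hM v x (not_not.1 hx)).not.congr
    fun _ => not_forall_not.symm

theorem ball (i : Fin n)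
    (hR : IsAbsolute fun w : Fin (n + 1) → ZFSet.{u} =>
      R (fun k => w k.castSucc) (w (Fin.last n))) :
    IsAbsolute fun v => ∀ x ∈ v i, R v x :=
  all ((mem _ _).imp hR) fun _ hM v x hx => hM _ (v i).2 x (Classical.not_imp.1 hx).1

theorem bex (i : Fin n)
    (hR : IsAbsolute fun w : Fin (n + 1) → ZFSet.{u} =>
      R (fun k => w k.castSucc) (w (Fin.last n))) :
    IsAbsolute fun v => ∃ x ∈ v i, R v x :=
  ex ((mem _ _).and hR) fun _ hM v x hx => hM _ (v i).2 x hx.1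

theorem eq_empty (i : Fin n) : IsAbsolute fun v : Fin n → ZFSet.{u} => v i = ∅ :=
  (ball (R := fun _ x => ¬ x = x) i (eq _ _).not).congr fun v => by simp [ZFSet.eq_empty]

theorem eq_insert_self (i k : Fin n) :
    IsAbsolute fun v : Fin n → ZFSet.{u} => v i = insert (v k) (v k) := by
  have h : IsAbsolute fun v : Fin n → ZFSet.{u} =>
      (∀ x ∈ v i, x = v k ∨ x ∈ v k) ∧ v k ∈ v i ∧ ∀ x ∈ v k, x ∈ v i :=
    (ball _ ((eq _ _).or (mem _ _))).and ((mem _ _).and (ball _ (mem _ _)))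
  refine h.congr fun v => ?_
  rw [ZFSet.ext_iff]
  simp only [ZFSet.mem_insert_iff]
  grind

theorem eq_inter (i k l : Fin n) :
    IsAbsolute fun v : Fin n → ZFSet.{u} => v i = v k ∩ v l := by
  have h : IsAbsolute fun v : Fin n → ZFSet.{u} =>
      (∀ x ∈ v i, x ∈ v k ∧ x ∈ v l) ∧ ∀ x ∈ v k, x ∈ v l → x ∈ v i :=
    (ball _ ((mem _ _).and (mem _ _))).and (ball _ ((mem _ _).imp (mem _ _)))
  refine h.congr fun v => ?_
  simp only [ZFSet.ext_iff, ZFSet.mem_inter]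
  grind

theorem eq_insert_singleton (i k l : Fin n) :
    IsAbsolute fun v : Fin n → ZFSet.{u} => v i = {v k, v l} := by
  have h : IsAbsolute fun v : Fin n → ZFSet.{u} =>
      v k ∈ v i ∧ v l ∈ v i ∧ ∀ x ∈ v i, x = v k ∨ x = v l :=
    (mem _ _).and ((mem _ _).and (ball _ ((eq _ _).or (eq _ _))))
  refine h.congr fun v => ?_
  rw [ZFSet.ext_iff]
  simp only [ZFSet.mem_pair]
  grind

theorem eq_pair (i k l : Fin n) :
    IsAbsolute fun v : Fin n → ZFSet.{u} => v i = ZFSet.pair (v k) (v l) := by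
  have h : IsAbsolute fun v : Fin n → ZFSet.{u} =>
      ∃ s ∈ v i, ∃ t ∈ v i, s = {v k, v k} ∧ t = {v k, v l} ∧ v i = {s, t} :=
    bex _ (bex _ ((eq_insert_singleton _ _ _).and
      ((eq_insert_singleton _ _ _).and (eq_insert_singleton _ _ _))))
  refine h.congr fun v => ⟨fun h => ?_, ?_⟩
  · exact ⟨{v k, v k}, by simp [h, ZFSet.pair], {v k, v l}, by simp [h, ZFSet.pair], rfl, rfl,
      by rw [h, ZFSet.pair, ZFSet.pair_eq_singleton]⟩
  · rintro ⟨_, -, _, -, rfl, rfl, h⟩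
    rw [h, ZFSet.pair, ZFSet.pair_eq_singleton]

theorem pair_mem (i k l : Fin n) :
    IsAbsolute fun v : Fin n → ZFSet.{u} => ZFSet.pair (v k) (v l) ∈ v i :=
  (bex (R := fun v z => z = ZFSet.pair (v k) (v l)) i (eq_pair _ _ _)).congr fun _ => by simp

theorem forall_snd_mem (i k : Fin n)
    (hR : IsAbsolute fun w : Fin (n + 1) → ZFSet.{u} =>
      R (fun k => w k.castSucc) (w (Fin.last n))) :
    IsAbsolute fun v => ∀ y, ZFSet.pair (v k) y ∈ v i → R v y :=
  all ((pair_mem _ _ _).imp hR) fun _ hM v _ hy =>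
    (hM.mem_of_pair_mem (hM _ (v i).2 _ (Classical.not_imp.1 hy).1)).2

theorem forall_pair_mem {S : (Fin n → ZFSet.{u}) → ZFSet.{u} → ZFSet.{u} → Prop} (i : Fin n)
    (hS : IsAbsolute fun w : Fin (n + 2) → ZFSet.{u} =>
      S (fun k => w k.castSucc.castSucc) (w (Fin.last n).castSucc) (w (Fin.last (n + 1)))) :
    IsAbsolute fun v => ∀ x y, ZFSet.pair x y ∈ v i → S v x y := by
  refine all (forall_snd_mem i.castSucc (Fin.last n)
    (R := fun w y => S (fun k => w k.castSucc) (w (Fin.last n)) y) hS) fun M hM v x hx => ?_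
  push Not at hx
  obtain ⟨y, hxy, -⟩ := hx
  exact (hM.mem_of_pair_mem (hM _ (v i).2 _ hxy)).1

theorem isTransitive (i : Fin n) :
    IsAbsolute fun v : Fin n → ZFSet.{u} => (v i).IsTransitive :=
  ball (R := fun v x => ∀ y ∈ x, y ∈ v i) i (ball _ (mem _ _))

theorem exists_eq_pair_left (i k : Fin n) :
    IsAbsolute fun v : Fin n → ZFSet.{u} => ∃ y, v i = ZFSet.pair (v k) y :=
  ex (R := fun v y => v i = ZFSet.pair (v k) y) (eq_pair _ _ _) fun _ hM v _ h =>
    (hM.mem_of_pair_mem (Set.mem_of_eq_of_mem h.symm (v i).2)).2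

theorem exists_eq_pair (i : Fin n) :
    IsAbsolute fun v : Fin n → ZFSet.{u} => ∃ x y, v i = ZFSet.pair x y :=
  ex (R := fun v x => ∃ y, v i = ZFSet.pair x y) (exists_eq_pair_left _ _) fun _ hM v _ ⟨_, h⟩ =>
    (hM.mem_of_pair_mem (Set.mem_of_eq_of_mem h.symm (v i).2)).1

theorem isFunction (i : Fin n) : IsAbsolute fun v : Fin n → ZFSet.{u} => IsFunction (v i) := by
  have hpairs : IsAbsolute fun v : Fin n → ZFSet.{u} => ∀ z ∈ v i, ∃ x y, z = ZFSet.pair x y :=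
    ball _ (exists_eq_pair _)
  have hunique : IsAbsolute fun v : Fin n → ZFSet.{u} =>
      ∀ x y, ZFSet.pair x y ∈ v i → ∀ y', ZFSet.pair x y' ∈ v i → y = y' :=
    forall_pair_mem _ (forall_snd_mem _ _ (eq _ _))
  exact (hpairs.and hunique).congr fun v => and_congr_right fun _ =>
    ⟨fun h x y hy y' => h x y y' hy, fun h x y y' hy => h x y hy y'⟩

variable {M : Set ZFSet.{u}}

theorem map_iff (hP : IsAbsolute P) (hM : IsTransitiveClass M) (j : ZFSet.{u} ↪ₑ[setLang] M)
    (v : Fin n → ZFSet.{u}) : P (fun i => (j (v i) : ZFSet.{u})) ↔ P v := by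
  obtain ⟨φ, hφV, hφM⟩ := hP
  rw [← hφM M hM fun i => j (v i), ← hφV, ← j.map_boundedFormula φ Empty.elim v,
    Subsingleton.elim (j ∘ Empty.elim) Empty.elim]
  rfl

theorem map_apply {F : (Fin n → ZFSet.{u}) → ZFSet.{u}}
    (hF : IsAbsolute fun w : Fin (n + 1) → ZFSet.{u} => w (Fin.last n) = F fun k => w k.castSucc)
    (hM : IsTransitiveClass M) (j : ZFSet.{u} ↪ₑ[setLang] M) (v : Fin n → ZFSet.{u}) :
    (j (F v) : ZFSet.{u}) = F fun k => j (v k) := by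
  simpa using hF.map_iff hM j (Fin.snoc v (F v))

theorem apply_mem {F : (Fin n → ZFSet.{u}) → ZFSet.{u}}
    (hF : IsAbsolute fun w : Fin (n + 1) → ZFSet.{u} => w (Fin.last n) = F fun k => w k.castSucc)
    (hM : IsTransitiveClass M) (j : ZFSet.{u} ↪ₑ[setLang] M) (v : Fin n → M) :
    F (fun k => v k) ∈ M := by
  obtain ⟨φ, hφV, hφM⟩ := hF
  have hV : φ.ex.alls.Realize (Empty.elim : Empty → ZFSet.{u}) := by
    simp only [BoundedFormula.realize_alls, BoundedFormula.realize_ex, hφV, Fin.snoc_last,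
      Fin.snoc_castSucc]
    exact fun v => ⟨F v, rfl⟩
  rw [← j.map_formula, Subsingleton.elim (j ∘ Empty.elim) Empty.elim] at hV
  simp only [BoundedFormula.realize_alls, BoundedFormula.realize_ex, hφM M hM, Fin.snoc_last,
    Fin.snoc_castSucc] at hV
  obtain ⟨r, hr⟩ := hV v
  exact hr ▸ r.2

end IsAbsolute

/-! ### Supercompactness embeddings -/

/-- The restriction of the relation `s` to the domain `d`. -/
noncomputable def restrict (s d : ZFSet.{u}) : ZFSet.{u} :=
  ZFSet.sep (fun z => ∃ x ∈ d, ∃ y, z = ZFSet.pair x y) s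

theorem IsAbsolute.eq_restrict {n : ℕ} (i k l : Fin n) :
    IsAbsolute fun v : Fin n → ZFSet.{u} => v i = restrict (v k) (v l) := by
  have h : IsAbsolute fun v : Fin n → ZFSet.{u} =>
      (∀ z ∈ v i, z ∈ v k ∧ ∃ x ∈ v l, ∃ y, z = ZFSet.pair x y) ∧
      ∀ z ∈ v k, (∃ x ∈ v l, ∃ y, z = ZFSet.pair x y) → z ∈ v i :=
    (ball _ ((mem _ _).and (bex _ (exists_eq_pair_left _ _)))).and
      (ball _ ((bex _ (exists_eq_pair_left _ _)).imp (mem _ _)))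
  refine h.congr fun v => ?_
  rw [ZFSet.ext_iff]
  simp only [restrict, ZFSet.mem_sep]
  grind

theorem IsTransitiveClass.restrict_mem {M : Set ZFSet.{u}} (hM : IsTransitiveClass M)
    (j : ZFSet.{u} ↪ₑ[setLang] M) {s d : ZFSet.{u}} (hs : s ∈ M) (hd : d ∈ M) :
    restrict s d ∈ M :=
  (IsAbsolute.eq_restrict (2 : Fin 3) 0 1).apply_mem (F := fun v => restrict (v 0) (v 1)) hM j
    ![⟨s, hs⟩, ⟨d, hd⟩]

theorem exists_isFunc_insert_restrict_eq {a b D s : ZFSet.{u}} (hab : a ⊆ b) (c : ZFSet.{u})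
    (hs : ZFSet.IsFunc a D s) : ∃ s', ZFSet.IsFunc b (insert c D) s' ∧ restrict s' a = s := by
  have mem_iff (x y : ZFSet.{u}) : ZFSet.pair x y ∈ s ∪ (b \ a).prod {c} ↔
      ZFSet.pair x y ∈ s ∨ (x ∈ b ∧ x ∉ a) ∧ y = c := by
    simp only [ZFSet.mem_union, ZFSet.pair_mem_prod, ZFSet.mem_sdiff, ZFSet.mem_singleton]
  have mem_dom {x y : ZFSet.{u}} (h : ZFSet.pair x y ∈ s) : x ∈ a :=
    (ZFSet.pair_mem_prod.1 (hs.1 h)).1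
  refine ⟨s ∪ (b \ a).prod {c}, ⟨fun z hz => ?_, fun x hx => ?_⟩, ?_⟩
  · rcases ZFSet.mem_union.1 hz with hz | hz
    · obtain ⟨x, hx, y, hy, rfl⟩ := ZFSet.mem_prod.1 (hs.1 hz)
      exact ZFSet.pair_mem_prod.2 ⟨hab hx, ZFSet.mem_insert_of_mem _ hy⟩
    · obtain ⟨x, hx, y, hy, rfl⟩ := ZFSet.mem_prod.1 hz
      rw [ZFSet.mem_singleton] at hy
      exact ZFSet.pair_mem_prod.2 ⟨(ZFSet.mem_sdiff.1 hx).1, ZFSet.mem_insert_iff.2 (.inl hy)⟩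
  · simp only [mem_iff]
    by_cases hxa : x ∈ a
    · simpa [hxa] using hs.2 x hxa
    · exact ⟨c, .inr ⟨⟨hx, hxa⟩, rfl⟩,
        fun y hy => (hy.resolve_left fun h => hxa (mem_dom h)).2⟩
  · ext z
    rw [restrict, ZFSet.mem_sep]
    constructor
    · rintro ⟨hz, x, hx, y, rfl⟩
      exact ((mem_iff x y).1 hz).resolve_right fun h => h.1.2 hx
    · intro hz
      obtain ⟨x, hx, y, -, rfl⟩ := ZFSet.mem_prod.1 (hs.1 hz)
      exact ⟨ZFSet.mem_union.2 (.inl hz), x, hx, y, rfl⟩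

theorem toZFSet_mem_cardSet {κ : Cardinal.{u}} {o : Ordinal.{u}} :
    o.toZFSet ∈ cardSet κ ↔ o < κ.ord :=
  Ordinal.toZFSet_mem_toZFSet_iff

theorem isTransitive_cardSet (κ : Cardinal.{u}) : (cardSet κ).IsTransitive :=
  (ZFSet.isOrdinal_toZFSet _).isTransitive

theorem IsTransitiveClass.map_toZFSet_natCast {M : Set ZFSet.{u}} (hM : IsTransitiveClass M)
    (j : ZFSet.{u} ↪ₑ[setLang] M) (n : ℕ) :
    (j (n : Ordinal.{u}).toZFSet : ZFSet.{u}) = (n : Ordinal.{u}).toZFSet := by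
  induction n with
  | zero =>
    rw [Nat.cast_zero, Ordinal.toZFSet_zero]
    exact (IsAbsolute.eq_empty (0 : Fin 1)).map_apply (F := fun _ => ∅) hM j ![]
  | succ n ih =>
    rw [Nat.cast_succ, Ordinal.toZFSet_add_one]
    have h := (IsAbsolute.eq_insert_self (1 : Fin 2) 0).map_apply
      (F := fun v => insert (v 0) (v 0)) hM j ![(n : Ordinal.{u}).toZFSet]
    simpa only [Matrix.cons_val_zero, ih] using h

namespace IsSupercompactnessEmbedding

variable {κ θ : Cardinal.{u}} {M : Set ZFSet.{u}} {j : ZFSet.{u} ↪ₑ[setLang] M}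

theorem isTransitiveClass (hj : IsSupercompactnessEmbedding κ θ M j) : IsTransitiveClass M :=
  hj.transitive

theorem aleph0_le (hj : IsSupercompactnessEmbedding κ θ M j) : ℵ₀ ≤ κ := by
  by_contra! hκ
  obtain ⟨n, rfl⟩ := Cardinal.lt_aleph0.1 hκ
  refine hj.move ?_
  rw [cardSet, Cardinal.ord_natCast]
  exact hj.isTransitiveClass.map_toZFSet_natCast j n

theorem mono {θ' : Cardinal.{u}} (hj : IsSupercompactnessEmbedding κ θ' M j) (hθ : θ ≤ θ') :
    IsSupercompactnessEmbedding κ θ M j where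
  transitive := hj.transitive
  ordinals := hj.ordinals
  fix := hj.fix
  move := hj.move
  lt_image := by
    have htrans : (j (cardSet κ) : ZFSet.{u}).IsTransitive :=
      ((IsAbsolute.isTransitive (0 : Fin 1)).map_iff hj.isTransitiveClass j ![cardSet κ]).2
        (isTransitive_cardSet κ)
    rcases hθ.eq_or_lt with rfl | h
    · exact hj.lt_image
    · exact htrans _ hj.lt_image (toZFSet_mem_cardSet.2 (Cardinal.ord_lt_ord.2 h))
  closed D s hD hs := by
    have hsub : cardSet θ ⊆ cardSet θ' :=
      Ordinal.toZFSet_subset_toZFSet_iff.2 (Cardinal.ord_le_ord.2 hθ)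
    have h0 : ∅ ∈ M := Ordinal.toZFSet_zero ▸ hj.ordinals 0
    obtain ⟨s', hs', rfl⟩ := exists_isFunc_insert_restrict_eq hsub ∅ hs
    have hD' : ∀ y ∈ insert ∅ D, y ∈ M := by simpa [h0] using hD
    exact hj.isTransitiveClass.restrict_mem j (hj.closed _ s' hD' hs') (hj.ordinals θ.ord)

theorem image_inter (hj : IsSupercompactnessEmbedding κ θ M j) {A : ZFSet.{u}}
    (hA : A ⊆ cardSet κ) : (j A : ZFSet.{u}) ∩ cardSet κ = A := by
  have mem_iff {o : Ordinal.{u}} (ho : o < κ.ord) :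
      o.toZFSet ∈ (j A : ZFSet.{u}) ↔ o.toZFSet ∈ A := by
    have h := (IsAbsolute.mem (0 : Fin 2) 1).map_iff hj.isTransitiveClass j ![o.toZFSet, A]
    simpa [hj.fix o ho] using h
  ext x
  rw [ZFSet.mem_inter]
  constructor
  · rintro ⟨hx, hxκ⟩
    obtain ⟨o, ho, rfl⟩ := Ordinal.mem_toZFSet_iff.1 hxκ
    exact (mem_iff ho).1 hx
  · intro hx
    obtain ⟨o, ho, rfl⟩ := Ordinal.mem_toZFSet_iff.1 (hA hx)
    exact ⟨(mem_iff ho).2 hx, hA hx⟩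

end IsSupercompactnessEmbedding

/-! ### Closure properties of `H_μ` -/

section InH

variable {μ : Cardinal.{u}} {x y : ZFSet.{u}}

theorem InH.mono {ν : Cardinal.{u}} (hx : InH μ x) (h : μ ≤ ν) : InH ν x :=
  let ⟨t, ht, hxt, hc⟩ := hx
  ⟨t, ht, hxt, hc.trans_le h⟩

theorem InH.exists_mem (hμ : ℵ₀ ≤ μ) (hx : InH μ x) :
    ∃ t : ZFSet.{u}, t.IsTransitive ∧ x ∈ t ∧ t.card < μ := by
  obtain ⟨t, ht, hxt, hc⟩ := hx
  refine ⟨insert x t, fun y hy z hz => ?_, ZFSet.mem_insert _ _,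
    ZFSet.card_insert_le.trans_lt (Cardinal.add_lt_of_lt hμ hc (one_lt_aleph0.trans_le hμ))⟩
  rcases ZFSet.mem_insert_iff.1 hy with rfl | hy
  · exact ZFSet.mem_insert_of_mem _ (hxt hz)
  · exact ZFSet.mem_insert_of_mem _ (ht y hy hz)

theorem InH.of_forall_mem (hμ : μ.IsRegular) (hc : x.card < μ) (hx : ∀ y ∈ x, InH μ y) :
    InH μ x := by
  choose t htrans hmem hcard using fun i : Shrink x =>
    (hx _ ((equivShrink x).symm i).2).exists_mem hμ.aleph0_le
  refine ⟨ZFSet.iUnion t, ZFSet.IsTransitive.iUnion htrans, fun y hy => ?_, ?_⟩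
  · exact ZFSet.mem_iUnion.2 ⟨equivShrink x ⟨y, hy⟩, by simpa using hmem (equivShrink x ⟨y, hy⟩)⟩
  · have h := ZFSet.lift_card_iUnion_le_sum_card (f := t)
    rw [Cardinal.lift_id] at h
    exact h.trans_lt (Cardinal.sum_lt_of_isRegular hμ hc hcard)

theorem InH.range (hμ : μ.IsRegular) {ι : Type v} [Small.{u} ι] (hι : lift.{u} #ι < lift.{v} μ)
    {F : ι → ZFSet.{u}} (hF : ∀ i, InH μ (F i)) : InH μ (ZFSet.range F) := by
  refine .of_forall_mem hμ ?_ fun y hy => ?_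
  · exact Cardinal.lift_lt.1 (ZFSet.lift_card_range_le.trans_lt hι)
  · obtain ⟨i, rfl⟩ := ZFSet.mem_range.1 hy
    exact hF i

theorem InH.insert_singleton (hμ : μ.IsRegular) (hx : InH μ x) (hy : InH μ y) : InH μ {x, y} := by
  refine .of_forall_mem hμ ?_ fun z hz => ?_
  · exact ZFSet.card_insert_le.trans_lt (Cardinal.add_lt_of_lt hμ.aleph0_le
      (ZFSet.card_singleton.trans_lt (one_lt_aleph0.trans_le hμ.aleph0_le))
      (one_lt_aleph0.trans_le hμ.aleph0_le))
  · rcases ZFSet.mem_pair.1 hz with rfl | rfl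
    exacts [hx, hy]

theorem InH.pair (hμ : μ.IsRegular) (hx : InH μ x) (hy : InH μ y) : InH μ (ZFSet.pair x y) := by
  rw [ZFSet.pair, ← ZFSet.pair_eq_singleton x]
  exact (hx.insert_singleton hμ hx).insert_singleton hμ (hx.insert_singleton hμ hy)

theorem InH.of_subset_cardSet {κ : Cardinal.{u}} (hκ : κ < μ) (hx : x ⊆ cardSet κ) : InH μ x :=
  ⟨cardSet κ, isTransitive_cardSet κ, hx, by simpa [cardSet] using hκ⟩

end InH

/-! ### Laver functions and joint Laver sequences -/

theorem IsLaverFunction.aleph0_le {κ θ : Cardinal.{u}} {ℓ : ZFSet.{u}}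
    (hℓ : IsLaverFunction κ θ ℓ) : ℵ₀ ≤ κ := by
  obtain ⟨M, j, hj, -⟩ := hℓ.2 ∅ ⟨∅, ZFSet.isTransitive_empty, subset_rfl, by simp⟩
  exact hj.aleph0_le

theorem isJointLaverSequence_iff {κ θ : Cardinal.{u}} {Λ : Ordinal.{u}}
    {L : Set.Iio Λ → ZFSet.{u}} :
    IsJointLaverSequence κ θ Λ L ↔
      (∀ α, ZFSet.IsFunc (cardSet κ) (ZFSet.vonNeumann κ.ord) (L α)) ∧
      ∀ a : Set.Iio Λ → ZFSet.{u}, (∀ α, InH (Order.succ θ) (a α)) →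
        ∃ (M : Set ZFSet.{u}) (j : ZFSet.{u} ↪ₑ[setLang] M),
          IsSupercompactnessEmbedding κ θ M j ∧ ∀ α, Guesses κ j (L α) (a α) := by
  refine ⟨fun h => ⟨fun α => (h.1 α).1, h.2⟩, fun h => ⟨fun α => ⟨h.1 α, fun a ha => ?_⟩, h.2⟩⟩
  -- `L α` guesses `a` via any embedding that guesses the constant sequence of targets `a`.
  obtain ⟨M, j, hj, hguess⟩ := h.2 (fun _ => a) fun _ => ha
  exact ⟨M, j, hj, hguess α⟩

theorem IsJointLaverSequence.mono {κ θ θ' : Cardinal.{u}} {Λ : Ordinal.{u}}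
    {L : Set.Iio Λ → ZFSet.{u}} (hL : IsJointLaverSequence κ θ' Λ L) (hθ : θ ≤ θ') :
    IsJointLaverSequence κ θ Λ L := by
  rw [isJointLaverSequence_iff] at hL ⊢
  refine ⟨hL.1, fun a ha => ?_⟩
  obtain ⟨M, j, hj, hguess⟩ := hL.2 a fun α => (ha α).mono (Order.succ_le_succ hθ)
  exact ⟨M, j, hj.mono hθ, hguess⟩

/-! ### Slices of a Laver function -/

theorem isFunction_of_isFunc {x y f : ZFSet.{u}} (hf : ZFSet.IsFunc x y f) : IsFunction f := by
  refine ⟨fun z hz => ?_, fun a b b' h h' => ?_⟩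
  · obtain ⟨a, -, b, -, rfl⟩ := ZFSet.mem_prod.1 (hf.1 hz)
    exact ⟨a, b, rfl⟩
  · exact (hf.2 a (ZFSet.pair_mem_prod.1 (hf.1 h)).1).unique h h'

theorem isFunction_range_pair {ι : Type v} [Small.{u} ι] {f : ι → ZFSet.{u}}
    (hf : Function.Injective f) (a : ι → ZFSet.{u}) :
    IsFunction (ZFSet.range fun i => ZFSet.pair (f i) (a i)) := by
  refine ⟨fun z hz => ?_, fun x y y' h h' => ?_⟩
  · obtain ⟨i, rfl⟩ := ZFSet.mem_range.1 hz
    exact ⟨_, _, rfl⟩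
  · obtain ⟨i, hi⟩ := ZFSet.mem_range.1 h
    obtain ⟨k, hk⟩ := ZFSet.mem_range.1 h'
    obtain ⟨rfl, rfl⟩ := ZFSet.pair_injective hi
    obtain ⟨hik, rfl⟩ := ZFSet.pair_injective hk
    rw [hf hik]

theorem eval_eq {g x y : ZFSet.{u}} (hg : IsFunction g) (h : ZFSet.pair x y ∈ g) :
    eval g x = y := by
  have hx : IsFunction g ∧ ∃ y, ZFSet.pair x y ∈ g := ⟨hg, y, h⟩
  rw [eval, dif_pos hx]
  exact hg.2 _ _ _ hx.2.choose_spec h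

theorem eval_eq_empty_or_pair_mem (g x : ZFSet.{u}) :
    eval g x = ∅ ∨ ZFSet.pair x (eval g x) ∈ g := by
  by_cases hx : IsFunction g ∧ ∃ y, ZFSet.pair x y ∈ g
  · rw [eval, dif_pos hx]
    exact .inr hx.2.choose_spec
  · rw [eval, dif_neg hx]
    exact .inl rfl

theorem IsTransitiveClass.eval_mem {M : Set ZFSet.{u}} (hM : IsTransitiveClass M) (h0 : ∅ ∈ M)
    {g : ZFSet.{u}} (hg : g ∈ M) (x : ZFSet.{u}) : eval g x ∈ M := by
  rcases eval_eq_empty_or_pair_mem g x with h | h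
  · rwa [h]
  · exact (hM.mem_of_pair_mem (hM g hg _ h)).2

theorem pair_eval_mem_slice {κ : Cardinal.{u}} {ξ : ZFSet.{u}} (ℓ A : ZFSet.{u})
    (hξ : ξ ∈ cardSet κ) : ZFSet.pair ξ (eval (eval ℓ ξ) (A ∩ ξ)) ∈ slice κ ℓ A := by
  obtain ⟨o, ho, rfl⟩ := Ordinal.mem_toZFSet_iff.1 hξ
  exact ZFSet.mem_range.2 ⟨⟨o, ho⟩, rfl⟩

section Slice

variable {κ : Cardinal.{u}} {ℓ : ZFSet.{u}}

theorem isFunc_slice (hℓ : ZFSet.IsFunc (cardSet κ) (ZFSet.vonNeumann κ.ord) ℓ) (A : ZFSet.{u}) :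
    ZFSet.IsFunc (cardSet κ) (ZFSet.vonNeumann κ.ord) (slice κ ℓ A) := by
  refine ⟨fun z hz => ?_, fun ξ hξ => ⟨_, pair_eval_mem_slice ℓ A hξ, fun y hy => ?_⟩⟩
  · obtain ⟨⟨o, ho⟩, rfl⟩ := ZFSet.mem_range.1 hz
    have hoκ : o.toZFSet ∈ cardSet κ := toZFSet_mem_cardSet.2 ho
    have hV : IsTransitiveClass (ZFSet.vonNeumann κ.ord : Set ZFSet.{u}) := fun x hx _ hy =>
      ZFSet.isTransitive_vonNeumann κ.ord x hx hy
    have h0 : ∅ ∈ ZFSet.vonNeumann κ.ord := by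
      rw [ZFSet.mem_vonNeumann, ZFSet.rank_empty]
      exact zero_le.trans_lt ho
    obtain ⟨g, hg, -⟩ := hℓ.2 _ hoκ
    rw [eval_eq (isFunction_of_isFunc hℓ) hg]
    exact ZFSet.pair_mem_prod.2 ⟨hoκ, hV.eval_mem h0 (ZFSet.pair_mem_prod.1 (hℓ.1 hg)).2 _⟩
  · obtain ⟨o, ho⟩ := ZFSet.mem_range.1 hy
    obtain ⟨rfl, rfl⟩ := ZFSet.pair_injective ho
    rfl

theorem pair_mem_slice {Y A ξ g y : ZFSet.{u}} (hℓ : ZFSet.IsFunc (cardSet κ) Y ℓ)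
    (hξ : ZFSet.pair ξ g ∈ ℓ) (hg : IsFunction g) (hy : ZFSet.pair (A ∩ ξ) y ∈ g) :
    ZFSet.pair ξ y ∈ slice κ ℓ A := by
  have h := pair_eval_mem_slice ℓ A (ZFSet.pair_mem_prod.1 (hℓ.1 hξ)).1
  rwa [eval_eq (isFunction_of_isFunc hℓ) hξ, eval_eq hg hy] at h

theorem IsAbsolute.forall_pair_inter_mem :
    IsAbsolute fun v : Fin 3 → ZFSet.{u} => ∀ ξ g, ZFSet.pair ξ g ∈ v 0 → IsFunction g →
      ∀ B y, ZFSet.pair B y ∈ g → B = v 1 ∩ ξ → ZFSet.pair ξ y ∈ v 2 := by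
  have h : IsAbsolute fun w : Fin 5 → ZFSet.{u} =>
      ∀ B y, ZFSet.pair B y ∈ w 4 → B = w 1 ∩ w 3 → ZFSet.pair (w 3) y ∈ w 2 :=
    forall_pair_mem (S := fun w B y => B = w 1 ∩ w 3 → ZFSet.pair (w 3) y ∈ w 2) 4
      ((eq_inter _ _ _).imp (pair_mem _ _ _))
  exact forall_pair_mem (S := fun v ξ g => IsFunction g →
    ∀ B y, ZFSet.pair B y ∈ g → B = v 1 ∩ ξ → ZFSet.pair ξ y ∈ v 2) 0 ((isFunction _).imp h)

variable {θ : Cardinal.{u}}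

theorem guesses_slice {Y A g y : ZFSet.{u}} {M : Set ZFSet.{u}} {j : ZFSet.{u} ↪ₑ[setLang] M}
    (hj : IsSupercompactnessEmbedding κ θ M j) (hℓ : ZFSet.IsFunc (cardSet κ) Y ℓ)
    (hA : A ⊆ cardSet κ) (hguess : Guesses κ j ℓ g) (hg : IsFunction g)
    (hy : ZFSet.pair A y ∈ g) : Guesses κ j (slice κ ℓ A) y := by
  have h := IsAbsolute.forall_pair_inter_mem.map_iff hj.isTransitiveClass j ![ℓ, A, slice κ ℓ A]
  refine h.2 (fun ξ g hξ hg B y hy hB => ?_) _ g hguess hg A y hy (hj.image_inter hA).symm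
  exact pair_mem_slice hℓ hξ hg (hB ▸ hy)

theorem isJointLaverSequence_slice (hκ : κ ≤ θ) (hℓ : IsLaverFunction κ θ ℓ) {Λ : Ordinal.{u}}
    (hΛ : Λ.card ≤ θ) {f : Set.Iio Λ → ZFSet.{u}} (hf : Function.Injective f)
    (hfκ : ∀ α, f α ⊆ cardSet κ) :
    IsJointLaverSequence κ θ Λ fun α => slice κ ℓ (f α) := by
  refine isJointLaverSequence_iff.2 ⟨fun α => isFunc_slice hℓ.1 (f α), fun a ha => ?_⟩
  have hθ : (Order.succ θ).IsRegular := isRegular_succ (hℓ.aleph0_le.trans hκ)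
  have hΛθ : lift.{u} #(Set.Iio Λ) < lift.{u + 1} (Order.succ θ) := by
    rw [Cardinal.mk_Iio_ordinal, Cardinal.lift_lift, Cardinal.lift_lt, Order.lt_succ_iff]
    exact hΛ
  have hpair (α) : InH (Order.succ θ) (ZFSet.pair (f α) (a α)) :=
    (InH.of_subset_cardSet (Order.lt_succ_iff.2 hκ) (hfκ α)).pair hθ (ha α)
  obtain ⟨M, j, hj, hguess⟩ := hℓ.2 _ (InH.range hθ hΛθ hpair)
  exact ⟨M, j, hj, fun α => guesses_slice hj hℓ.1 (hfκ α) hguess (isFunction_range_pair hf a)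
    (ZFSet.mem_range.2 ⟨α, rfl⟩)⟩

end Slice

theorem exists_injective_subset_cardSet {κ μ : Cardinal.{u}} (hμ : μ ≤ 2 ^ κ) :
    ∃ f : Set.Iio μ.ord → ZFSet.{u}, Function.Injective f ∧ ∀ α, f α ⊆ cardSet κ := by
  have h : #(Set.Iio μ.ord) ≤ #((cardSet κ).powerset) := by
    rw [ZFSet.cardinalMk_coe_sort, ZFSet.card_powerset, Cardinal.mk_Iio_ordinal, Cardinal.lift_le]
    simpa [cardSet] using hμ
  obtain ⟨e⟩ := h
  exact ⟨fun α => e α, Subtype.val_injective.comp e.injective, fun α =>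
    ZFSet.mem_powerset.1 (e α).2⟩

end JointLaver

theorem proposition3p2 (κ : Cardinal.{u}) :
    -- A `θ`-supercompactness Laver function yields a joint Laver sequence of length
    -- `min {θ, 2 ^ κ}`.
    (∀ θ : Cardinal.{u}, κ ≤ θ → (∃ ℓ : ZFSet.{u}, JointLaver.IsLaverFunction κ θ ℓ) →
      ∃ L : Set.Iio (min θ (2 ^ κ)).ord → ZFSet.{u},
        JointLaver.IsJointLaverSequence κ θ (min θ (2 ^ κ)).ord L) ∧
    -- Explicitly, `ℓ_α(ξ) = ℓ(ξ)(f(α) ∩ ξ)` is such a sequence.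
    (∀ θ : Cardinal.{u}, κ ≤ θ → ∀ ℓ : ZFSet.{u}, JointLaver.IsLaverFunction κ θ ℓ →
      ∀ f : Set.Iio (min θ (2 ^ κ)).ord → ZFSet.{u}, Function.Injective f →
        (∀ α, f α ⊆ JointLaver.cardSet κ) →
        JointLaver.IsJointLaverSequence κ θ (min θ (2 ^ κ)).ord (fun α => JointLaver.slice κ ℓ (f α))) ∧
    -- A Laver function for all degrees yields a sequence of length `2 ^ κ` for all degrees.
    ((∃ ℓ : ZFSet.{u}, ∀ θ : Cardinal.{u}, κ ≤ θ → JointLaver.IsLaverFunction κ θ ℓ) →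
      ∃ L : Set.Iio ((2 : Cardinal.{u}) ^ κ).ord → ZFSet.{u},
        ∀ θ : Cardinal.{u}, κ ≤ θ →
          JointLaver.IsJointLaverSequence κ θ ((2 : Cardinal.{u}) ^ κ).ord L) := by
  have hcard (θ : Cardinal.{u}) : (min θ (2 ^ κ)).ord.card ≤ θ := by simp
  refine ⟨fun θ hκ ⟨ℓ, hℓ⟩ => ?_, fun θ hκ ℓ hℓ f hf hfκ =>
    JointLaver.isJointLaverSequence_slice hκ hℓ (hcard θ) hf hfκ, fun ⟨ℓ, hℓ⟩ => ?_⟩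
  · obtain ⟨f, hf, hfκ⟩ := JointLaver.exists_injective_subset_cardSet (min_le_right θ (2 ^ κ))
    exact ⟨_, JointLaver.isJointLaverSequence_slice hκ hℓ (hcard θ) hf hfκ⟩
  · obtain ⟨f, hf, hfκ⟩ := JointLaver.exists_injective_subset_cardSet (le_refl (2 ^ κ))
    refine ⟨fun α => JointLaver.slice κ ℓ (f α), fun θ hκ => ?_⟩
    have hmax : κ ≤ max θ (2 ^ κ) := hκ.trans (le_max_left _ _)
    exact (JointLaver.isJointLaverSequence_slice hmax (hℓ _ hmax) (by simp) hf hfκ).mono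
      (le_max_left _ _)
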